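/- Let $k\ge 3$ be an integer, let $\Sigma_k$ be an alphabet with $k$ letters, and let $\alpha\ge 5$ be a rational number. For a non-empty finite word $r$ over $\Sigma_k$ and a positive rational $\beta$ with $\beta|r|$ an integer, let $r^\beta=rr\cdots rt$, where $t$ is a prefix of $r$ and $|r^\beta|=\beta|r|$. A finite word is called $\alpha$-power-free if it has no factor (contiguous block of letters) of the form $r^\beta$ with $r$ non-empty and $\beta\ge\alpha$ rational; a bi-infinite word (a word indexed by $\mathbb{Z}$) is called $\alpha$-power-free if all its finite factors are. Let $v_1,v_2$ be bi-infinite $\alpha$-power-free words over $\Sigma_k$, let $w_3$ be a non-empty finite factor of $v_1$, and let $w_4$ be a non-empty finite factor of $v_2$. Then there are a finite (possibly empty) word $w_0$ over $\Sigma_k$ and a bi-infinite $\alpha$-power-free word $v$ over $\Sigma_k$ such that $w_3w_0w_4$ is a factor of $v$. -/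

import Mathlib

namespace PowerFreeWords

/-- `IsPower r β u` says that the finite word `u` is the `β`-power `r ^ β = r r ⋯ r t` of the
non-empty word `r`, where `t` is a prefix of `r` and `|r ^ β| / |r| = β`. -/
def IsPower {A : Type*} (r : List A) (β : ℚ) (u : List A) : Prop :=
  r ≠ [] ∧ 0 < β ∧
    (∃ (n : ℕ) (t : List A), t <+: r ∧ u = (List.replicate n r).flatten ++ t) ∧
    (u.length : ℚ) / (r.length : ℚ) = β

/-- A finite word is `α`-power-free if none of its factors is a `β`-power with `β ≥ α`.
The set of these words over `Fin k` is the language `L_{k,α}`. -/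
def PowerFree {A : Type*} (α : ℚ) (w : List A) : Prop :=
  ∀ (r : List A) (β : ℚ) (u : List A), u <:+: w → IsPower r β u → ¬ α ≤ β

/-- The finite word `w` is a factor of the bi-infinite word `v`: it is the block of `v` of
some length `n ≥ 0` that starts at some position `i`. -/
def IsFactor {A : Type*} (w : List A) (v : ℤ → A) : Prop :=
  ∃ (i : ℤ) (n : ℕ), w = (List.range n).map (fun j : ℕ => v (i + (j : ℤ)))

/-- A bi-infinite word is `α`-power-free if all its finite factors are `α`-power-free. -/
def BiPowerFree {A : Type*} (α : ℚ) (v : ℤ → A) : Prop :=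
  ∀ w : List A, IsFactor w v → PowerFree α w

end PowerFreeWords

namespace PowerFreeWords

/-! Every block of a power-free word can be transplanted into a power-free word whose two ends are
Thue–Morse words over two letters each, and such ends can be joined. Since neither ray of the given
word is periodic, Fine and Wilf's theorem allows the block to be enlarged until it neither begins
nor ends with a fourth power (`exists_block_no_fourth`). On each side a tail over two letters other
than the adjacent end letter is attached (`exists_tails`). A power that crosses from the block into
a tail enters it by less than one period. If its exponent is at least 5 and it meets one tail only,
it leaves a fourth power at an end of the block; if it meets both, the choice of the first letter of
the right tail excludes it. Tails over different pairs of letters are joined far out, where each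
side shows a letter foreign to the other (`PF.glue`). If the pairs agree, a word whose tails avoid
one of their letters is put in between (`PF.transition`). -/

/-- The block of `v` at the positions `s ≤ i < e` has period `p`. -/
def Per {A : Type*} (v : ℤ → A) (s e p : ℤ) : Prop :=
  ∀ i, s ≤ i → i + p < e → v i = v (i + p)

/-! ### Periods of blocks and the theorem of Fine and Wilf. -/

section Periods

variable {A : Type*} {v : ℤ → A}

theorem Per.mono {s e s' e' p : ℤ} (h : Per v s e p) (hs : s ≤ s') (he : e' ≤ e) :
    Per v s' e' p :=
  fun i h1 h2 => h i (by omega) (by omega)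

theorem Per.eq_add_mul {s e p : ℤ} (h : Per v s e p) (hp : 0 < p) (k : ℕ) :
    ∀ i, s ≤ i → i + p * k < e → v i = v (i + p * k) := by
  induction k with
  | zero => intro i _ _; simp
  | succ k ih =>
    intro i h1 h2
    push_cast at h2 ⊢
    have hk : 0 ≤ p * k := by positivity
    rw [ih i h1 (by linarith), h (i + p * k) (by linarith) (by linarith)]
    congr 1; ring

theorem Per.eq_of_dvd {s e p i j : ℤ} (h : Per v s e p) (hp : 0 < p) (hi : s ≤ i) (hi' : i < e)
    (hj : s ≤ j) (hj' : j < e) (hd : p ∣ j - i) : v i = v j := by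
  wlog hij : i ≤ j generalizing i j
  · exact (this hj hj' hi hi' (by rw [← neg_sub]; exact hd.neg_right) (by omega)).symm
  obtain ⟨k, hk⟩ := hd
  have hk0 : 0 ≤ k := by
    by_contra hneg
    have := mul_neg_of_pos_of_neg hp (not_le.mp hneg)
    omega
  lift k to ℕ using hk0
  have hj2 : j = i + p * k := by omega
  rw [hj2]
  exact h.eq_add_mul hp k i hi (by omega)

/-- A divisor of a period that is a period of a long enough block is a period. -/
theorem Per.extend {s e s' e' q d : ℤ} (h : Per v s e q) (hq : 0 < q) (hs : s ≤ s') (he : e' ≤ e)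
    (hl : q ≤ e' - s') (h' : Per v s' e' d) (hd : 0 < d) (hdq : d ∣ q) : Per v s e d := by
  intro i h1 h2
  have key : ∀ x : ℤ, ∃ y, s' ≤ y ∧ y < e' ∧ q ∣ y - x := by
    intro x
    refine ⟨s' + (x - s') % q, ?_, ?_, ?_⟩
    · have := Int.emod_nonneg (x - s') hq.ne'; omega
    · have := Int.emod_lt_of_pos (x - s') hq; omega
    · refine ⟨-((x - s') / q), ?_⟩
      have := Int.emod_add_mul_ediv (x - s') q
      linarith
  obtain ⟨y, hy1, hy2, hy3⟩ := key i
  obtain ⟨z, hz1, hz2, hz3⟩ := key (i + d)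
  rw [h.eq_of_dvd hq h1 (by omega) (by omega) (by omega) hy3,
    h.eq_of_dvd hq (i := i + d) (by omega) (by omega) (by omega) (by omega) hz3]
  refine h'.eq_of_dvd hd hy1 hy2 hz1 hz2 ?_
  have := dvd_sub (hdq.trans hz3) (hdq.trans hy3)
  have h3 := dvd_add this (dvd_refl d)
  rwa [show z - (i + d) - (y - i) + d = z - y by ring] at h3

/-- Subtractive Euclid: `q - p` is a period of the block shortened by `p`, and `Per.extend` carries
the divisor found there back to the whole block. -/
theorem Per.gcd_aux (n : ℕ) : ∀ {s e p q : ℤ}, 0 < p → 0 < q → p + q ≤ n → Per v s e p →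
    Per v s e q → p + q ≤ e - s → ∃ d, 0 < d ∧ d ∣ p ∧ d ∣ q ∧ Per v s e d := by
  induction n with
  | zero => intro s e p q hp hq hn; exfalso; push_cast at hn; omega
  | succ n ih =>
    intro s e p q hp hq hn h1 h2 hl
    wlog hpq : p ≤ q generalizing p q
    · obtain ⟨d, a, b, c, f⟩ := this hq hp (by omega) h2 h1 (by omega) (by omega)
      exact ⟨d, a, c, b, f⟩
    rcases hpq.eq_or_lt with rfl | hlt
    · exact ⟨p, hp, dvd_rfl, dvd_rfl, h1⟩
    have h3 : Per v s (e - p) (q - p) := by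
      intro i hi1 hi2
      rw [h2 i hi1 (by omega), h1 (i + (q - p)) (by omega) (by omega)]
      congr 1; ring
    push_cast at hn
    obtain ⟨d, hd, hdp, hdq, hper⟩ := ih (s := s) (e := e - p) hp (by omega : 0 < q - p) (by omega)
      (h1.mono le_rfl (by omega)) h3 (by omega)
    refine ⟨d, hd, hdp, ?_, ?_⟩
    · simpa using dvd_add hdq hdp
    · exact h1.extend hp le_rfl (by omega : e - p ≤ e) (by omega) hper hd hdp

/-- The theorem of Fine and Wilf, in a weak form. -/
theorem Per.gcd {s e p q : ℤ} (hp : 0 < p) (hq : 0 < q) (h1 : Per v s e p) (h2 : Per v s e q)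
    (hl : p + q ≤ e - s) : ∃ d, 0 < d ∧ d ∣ p ∧ d ∣ q ∧ Per v s e d :=
  Per.gcd_aux (p + q).toNat hp hq (by omega) h1 h2 hl

theorem Per.gcd_extend {s e s' e' p q : ℤ} (hp : 0 < p) (hq : 0 < q) (h1 : Per v s e q)
    (h2 : Per v s' e' p) (hs : s ≤ s') (he : e' ≤ e) (hl : p + q ≤ e' - s') :
    ∃ d, 0 < d ∧ d ∣ p ∧ d ∣ q ∧ Per v s e d := by
  obtain ⟨d, hd, hdp, hdq, hper⟩ := Per.gcd hp hq h2 (h1.mono hs he) hl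
  exact ⟨d, hd, hdp, hdq, h1.extend hq hs he (by omega) hper hd hdq⟩

theorem Per.reverse {s e p : ℤ} (h : Per v s e p) :
    Per (fun i => v (-i)) (1 - e) (1 - s) p := by
  intro i h1 h2
  have := h (-(i + p)) (by omega) (by omega)
  simp only [this]
  congr 1; ring

/-! ### Fourth powers at the ends of blocks. -/

/-- A fourth power of period `p` ends just before position `e`. -/
def FourthSuffix (v : ℤ → A) (e p : ℤ) : Prop :=
  0 < p ∧ Per v (e - 4 * p) e p

/-- A fourth power of period `p` starts at position `s`. -/
def FourthPrefix (v : ℤ → A) (s p : ℤ) : Prop :=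
  0 < p ∧ Per v s (s + 4 * p) p

theorem FourthPrefix.reverse {s p : ℤ} (h : FourthPrefix v s p) :
    FourthSuffix (fun i => v (-i)) (1 - s) p :=
  ⟨h.1, h.2.reverse.mono (by omega) le_rfl⟩

/-- If `q ≤ 3 * q'`, the two powers share at least `q + q'` positions and Fine–Wilf applies;
otherwise the shorter power, translated by `q`, stays inside the longer one. Hence the minimal
period cannot drop when one steps back by it. -/
theorem FourthSuffix.exists_lt {e q q' : ℤ} (h : FourthSuffix v e q)
    (h' : FourthSuffix v (e - q) q') (hlt : q' < q) : ∃ d, d < q ∧ FourthSuffix v e d := by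
  obtain ⟨hq, hper⟩ := h
  obtain ⟨hq', hper'⟩ := h'
  by_cases hc : q ≤ 3 * q'
  · obtain ⟨d, hd, hdp, -, hd2⟩ := Per.gcd_extend (s' := max (e - 4 * q) (e - q - 4 * q'))
      (e' := e - q) hq' hq hper (hper'.mono (by omega) le_rfl) (by omega) (by omega) (by omega)
    have := Int.le_of_dvd hq' hdp
    exact ⟨d, by omega, hd, hd2.mono (by omega) le_rfl⟩
  · refine ⟨q', hlt, hq', fun i h1 h2 => ?_⟩
    have e1 := hper (i - q) (by omega) (by omega)
    have e2 := hper (i + q' - q) (by omega) (by omega)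
    have e3 := hper' (i - q) (by omega) (by omega)
    simp only [sub_add_cancel] at e1 e2
    rw [← e1, ← e2, e3]
    congr 1; ring

theorem exists_minimal_fourthSuffix {e p : ℤ} (h : FourthSuffix v e p) :
    ∃ q, FourthSuffix v e q ∧ ∀ p, FourthSuffix v e p → q ≤ p :=
  Int.exists_least_of_bdd ⟨0, fun _ hz => hz.1.le⟩ ⟨p, h⟩

/-- If fourth powers of bounded period end everywhere, the word is eventually periodic. -/
theorem eventually_periodic_of_fourthSuffix {N K : ℤ}
    (h : ∀ e, N ≤ e → ∃ p, p ≤ K ∧ FourthSuffix v e p) :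
    ∃ Q N', 0 < Q ∧ Q ≤ K ∧ ∀ i, N' ≤ i → v i = v (i + Q) := by
  obtain ⟨Q, ⟨N', hN'⟩, hmin⟩ := Int.exists_least_of_bdd
    (P := fun Q => ∃ N', ∀ e, N' ≤ e → ∃ p, p ≤ Q ∧ FourthSuffix v e p)
    ⟨0, fun z ⟨N', hz⟩ => by obtain ⟨p, h1, h2⟩ := hz N' le_rfl; have := h2.1; omega⟩ ⟨K, N, h⟩
  have hQ : 0 < Q := by obtain ⟨p, h1, h2⟩ := hN' N' le_rfl; have := h2.1; omega
  refine ⟨Q, N', hQ, hmin K ⟨N, h⟩, fun i hi => ?_⟩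
  -- From an end whose least period is `Q`, a step back by `Q` reaches another such end, so the
  -- period propagates down to `i`. Minimality of `Q` provides such ends arbitrarily far out.
  have claim : ∀ n : ℕ, ∀ e, e ≤ N' + n → N' ≤ e → (∀ p, FourthSuffix v e p → Q ≤ p) →
      i + Q < e → v i = v (i + Q) := by
    intro n
    induction n with
    | zero => intro e h1 h2 h3 h4; push_cast at h1; omega
    | succ n ih =>
      intro e h1 h2 h3 h4
      obtain ⟨p, hp, hp'⟩ := hN' e h2
      obtain rfl : p = Q := le_antisymm hp (h3 p hp')
      by_cases hc : e - 4 * p ≤ i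
      · exact hp'.2 i hc h4
      · push_cast at h1
        refine ih (e - p) (by omega) (by omega) (fun p' hp'' => ?_) (by omega)
        by_contra hlt
        obtain ⟨d, hd1, hd2⟩ := hp'.exists_lt hp'' (not_le.mp hlt)
        exact absurd (h3 d hd2) (by omega)
  have hfreq : ∃ e, max N' (i + Q + 1) ≤ e ∧ ∀ p, FourthSuffix v e p → Q ≤ p := by
    by_contra hcon
    push Not at hcon
    have := hmin (Q - 1) ⟨_, fun e he => by
      obtain ⟨p, h1, h2⟩ := hcon e he
      exact ⟨p, by omega, h1⟩⟩
    omega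
  obtain ⟨e, he, he'⟩ := hfreq
  exact claim (e - N').toNat e (by omega) (by omega) he' (by omega)

/-- The block from `m` to a suitable far position has no fourth power as a suffix, unless the word
is eventually periodic. -/
theorem exists_no_fourthSuffix
    (hv : ∀ Q N, 0 < Q → ¬ ∀ i, N ≤ i → v i = v (i + Q)) (m N : ℤ) :
    ∃ e, N ≤ e ∧ ∀ p, FourthSuffix v e p → e - 4 * p < m := by
  by_contra hcon
  push Not at hcon
  -- Beyond `|4 * N - m|`, the inequality `4 * q ≤ e - m` keeps `e - q` at or after `N`. A bounded
  -- period ends there by induction, and a minimal `q` above the bound would contradict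
  -- `FourthSuffix.exists_lt`.
  have hb : ∀ n : ℕ, ∀ e, e ≤ N + n → N ≤ e →
      ∃ p, p ≤ |4 * N - m| - m ∧ FourthSuffix v e p := by
    intro n
    induction n using Nat.strong_induction_on with
    | _ n ih =>
      intro e h1 h2
      obtain ⟨p, hp, hpm⟩ := hcon e h2
      have hp0 := hp.1
      by_cases hc : e ≤ |4 * N - m|
      · exact ⟨p, by omega, hp⟩
      · obtain ⟨q, hq, hmin⟩ := exists_minimal_fourthSuffix hp
        have hqp := hmin p hp
        have hq0 := hq.1
        have habs := le_abs_self (4 * N - m)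
        have habs' := abs_nonneg (4 * N - m)
        obtain ⟨p', hp1, hp2⟩ := ih (e - q - N).toNat (by omega) (e - q) (by omega) (by omega)
        refine ⟨q, ?_, hq⟩
        by_contra hlt
        obtain ⟨d, hd1, hd2⟩ := hq.exists_lt hp2 (by omega)
        exact absurd (hmin d hd2) (by omega)
  obtain ⟨Q, N', hQ, -, h⟩ := eventually_periodic_of_fourthSuffix (v := v) (N := N)
    fun e he => hb (e - N).toNat e (by omega) he
  exact hv Q N' hQ h

/-- In a fourth power of minimal period, some position among the first `q` ones is the start of
no shorter fourth power. -/
theorem exists_smaller_period {a q : ℤ} (hq : 0 < q) (h : Per v a (a + 4 * q) q)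
    (hpre : ∀ m, a < m → m ≤ a + q → ∃ p, FourthPrefix v m p ∧ m + 4 * p ≤ a + 4 * q) :
    ∃ d, 0 < d ∧ d < q ∧ Per v a (a + 4 * q) d := by
  -- In the `q`-periodic extension `V`, a fourth power of period below `q` starts at every position.
  -- Reversed, `V` is eventually periodic with a period below `q`, and `q`-periodicity removes
  -- "eventually".
  set V : ℤ → A := fun i => v (a + (i - a) % q) with hV
  have hVq : ∀ i j, q ∣ j - i → V i = V j := by
    intro i j hij
    have : (i - a) % q = (j - a) % q :=
      Int.modEq_iff_dvd.2 (by rwa [sub_sub_sub_cancel_right])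
    simp only [hV, this]
  have hVv : ∀ i, a ≤ i → i < a + 4 * q → V i = v i := by
    intro i h1 h2
    have e1 := Int.emod_nonneg (i - a) hq.ne'
    have e2 := Int.emod_lt_of_pos (i - a) hq
    refine h.eq_of_dvd hq (by omega) (by omega) h1 h2 ⟨(i - a) / q, ?_⟩
    have := Int.emod_add_mul_ediv (i - a) q
    linarith
  have hsuf : ∀ e, (0 : ℤ) ≤ e → ∃ p, p ≤ q - 1 ∧ FourthSuffix (fun i => V (-i)) e p := by
    intro e _
    set r := (1 - e - (a + 1)) % q with hr
    have e1 : 0 ≤ r := Int.emod_nonneg _ hq.ne'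
    have e2 : r < q := Int.emod_lt_of_pos _ hq
    have e3 : q ∣ a + 1 + r - (1 - e) :=
      ⟨-((1 - e - (a + 1)) / q), by have := Int.emod_add_mul_ediv (1 - e - (a + 1)) q; linarith⟩
    obtain ⟨p, ⟨hp, hper⟩, hle⟩ := hpre (a + 1 + r) (by omega) (by omega)
    refine ⟨p, by omega, ?_⟩
    have : FourthPrefix V (1 - e) p := by
      refine ⟨hp, fun i h1 h2 => ?_⟩
      rw [hVq i (i + (a + 1 + r - (1 - e))) (by simpa using e3),
        hVq (i + p) (i + p + (a + 1 + r - (1 - e))) (by simpa using e3),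
        hVv _ (by omega) (by omega), hVv _ (by omega) (by omega),
        hper _ (by omega) (by omega)]
      congr 1; ring
    simpa using this.reverse
  obtain ⟨Q, N, hQ, hQq, hper⟩ := eventually_periodic_of_fourthSuffix hsuf
  refine ⟨Q, hQ, by omega, fun i h1 h2 => ?_⟩
  have hK : ∃ K : ℤ, N ≤ -(i + Q) + q * K := by
    refine ⟨|N + (i + Q)|, ?_⟩
    have := le_abs_self (N + (i + Q))
    nlinarith [abs_nonneg (N + (i + Q))]
  obtain ⟨K, hK⟩ := hK
  have e1 := hper _ hK
  rw [← hVv i h1 (by omega), ← hVv (i + Q) (by omega) h2,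
    hVq i (i - q * K) ⟨-K, by ring⟩, hVq (i + Q) (i + Q - q * K) ⟨-K, by ring⟩]
  rw [show -(-(i + Q) + q * K) = i + Q - q * K by ring,
    show -(-(i + Q) + q * K + Q) = i - q * K by ring] at e1
  exact e1.symm

theorem exists_no_fourthPrefix
    (hv : ∀ Q N, 0 < Q → ¬ ∀ i, i ≤ N → v i = v (i - Q)) (e N : ℤ) :
    ∃ m, m ≤ N ∧ ∀ p, FourthPrefix v m p → e < m + 4 * p := by
  obtain ⟨x, h1, h2⟩ := exists_no_fourthSuffix (v := fun i => v (-i)) (fun Q N' hQ hcon =>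
    hv Q (-N') hQ fun i hi => by
      have := hcon (-i) (by omega)
      simp only [neg_neg] at this
      rw [this]; congr 1; ring) (1 - e) (1 - N)
  refine ⟨1 - x, by omega, fun p hp => ?_⟩
  have := h2 p (by simpa using hp.reverse)
  omega

/-- Every block of a word that is not periodic on either side extends to a block that has no
fourth power as a prefix or as a suffix. -/
theorem exists_block_no_fourth
    (hR : ∀ Q N, 0 < Q → ¬ ∀ i, N ≤ i → v i = v (i + Q))
    (hL : ∀ Q N, 0 < Q → ¬ ∀ i, i ≤ N → v i = v (i - Q)) (M N : ℤ) :
    ∃ m e, m ≤ M ∧ N ≤ e ∧ (∀ p, FourthPrefix v m p → e < m + 4 * p) ∧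
      ∀ p, FourthSuffix v e p → e - 4 * p < m := by
  by_contra hcon
  push Not at hcon
  have hex : ∀ e, ∃ q, N ≤ e → FourthSuffix v e q ∧ ∀ p, FourthSuffix v e p → q ≤ p := by
    intro e
    by_cases he : N ≤ e
    swap
    · exact ⟨0, fun h => absurd h he⟩
    suffices h : ∃ p, FourthSuffix v e p by
      obtain ⟨p, hp⟩ := h
      obtain ⟨q, hq⟩ := exists_minimal_fourthSuffix hp
      exact ⟨q, fun _ => hq⟩
    obtain ⟨m, hm, hm'⟩ := exists_no_fourthPrefix hL e M
    obtain ⟨p, hp, -⟩ := hcon m e hm he hm'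
    exact ⟨p, hp⟩
  choose f hf using hex
  -- Otherwise each `m` in the first period satisfies `m ≤ M`. A fourth power ending the block from
  -- `m` to `e` would have a period below the minimal one, so by `hcon` one begins it, and
  -- `exists_smaller_period` contradicts minimality.
  have hshort : ∀ e, N ≤ e → e - 4 * f e < M → M - (e - 4 * f e) < f e := by
    intro e he hM
    by_contra hlt
    obtain ⟨⟨hq, hper⟩, hmin⟩ := hf e he
    have hee : e - 4 * f e + 4 * f e = e := by ring
    obtain ⟨d, hd, hdq, hdper⟩ := exists_smaller_period (v := v) (a := e - 4 * f e) hq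
      (by rwa [hee]) (by
        intro m h1 h2
        by_contra hno
        push Not at hno
        obtain ⟨p, hp1, hp2⟩ := hcon m e (by omega) he
          (fun p hp => by have := hno p hp; omega)
        have := hmin p hp1
        omega)
    have := hmin d ⟨hd, hdper.mono (by omega) (by omega)⟩
    omega
  obtain ⟨e₁, he₁, hm₁⟩ := exists_no_fourthSuffix hR M N
  have ha₁ := hm₁ _ (hf e₁ he₁).1
  -- The first end after `e₁` whose minimal fourth power starts before that of `e₁`.
  obtain ⟨e, ⟨hee, hae⟩, hmin⟩ := Int.exists_least_of_bdd
    (P := fun e => e₁ < e ∧ e - 4 * f e < e₁ - 4 * f e₁) ⟨e₁, fun z hz => hz.1.le⟩ (by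
      obtain ⟨e, h1, h2⟩ := exists_no_fourthSuffix hR (e₁ - 4 * f e₁) (e₁ + 1)
      exact ⟨e, by omega, h2 _ (hf e (by omega)).1⟩)
  have hs := hshort e (by omega) (by omega)
  obtain ⟨h1, hmin1⟩ := hf e₁ he₁
  obtain ⟨h2, hmin2⟩ := hf e (by omega)
  have hq1 := h1.1
  have hq2 := h2.1
  by_cases hc : e₁ ≤ e - f e
  · have h3 := (hf (e - f e) (by omega)).1
    have hle : f e ≤ f (e - f e) := by
      by_contra hlt
      obtain ⟨d, hd, hd'⟩ := h2.exists_lt h3 (by omega)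
      exact absurd (hmin2 d hd') (by omega)
    rcases hc.eq_or_lt with heq | hlt
    · rw [← heq] at hle; omega
    · by_cases hx : e - f e - 4 * f (e - f e) < e₁ - 4 * f e₁
      · have := hmin (e - f e) ⟨hlt, hx⟩
        omega
      · omega
  -- The power at `e₁` lies inside the one at `e`, and `hshort` gives `4 * f e₁ > 2 * f e`, enough
  -- for Fine–Wilf.
  · obtain ⟨d, hd, hdp, hdq, hdper⟩ := Per.gcd_extend hq1 hq2 h2.2 h1.2 (by omega) (by omega)
      (by omega)
    have hle := hmin2 d ⟨hd, hdper.mono (by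
      have := Int.le_of_dvd hq2 hdq
      omega) le_rfl⟩
    have := Int.le_of_dvd hq1 hdp
    omega

end Periods

/-! ### The Thue–Morse sequence. -/

/-- The Thue–Morse sequence. -/
def thueMorse : ℕ → Bool
  | 0 => false
  | n + 1 => xor (thueMorse ((n + 1) / 2)) (decide ((n + 1) % 2 = 1))
decreasing_by omega

theorem thueMorse_two_mul (n : ℕ) : thueMorse (2 * n) = thueMorse n := by
  rcases n with _ | n
  · rfl
  · rw [show 2 * (n + 1) = (2 * n + 1) + 1 by ring, thueMorse,
      show (2 * n + 1 + 1) / 2 = n + 1 by omega, show (2 * n + 1 + 1) % 2 = 0 by omega]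
    simp

theorem thueMorse_two_mul_add_one (n : ℕ) : thueMorse (2 * n + 1) = !thueMorse n := by
  rw [thueMorse, show (2 * n + 1) / 2 = n by omega, show (2 * n + 1) % 2 = 1 by omega]
  simp

theorem thueMorse_ne_succ {n : ℕ} (h : n % 2 = 0) : thueMorse n ≠ thueMorse (n + 1) := by
  obtain ⟨j, rfl⟩ : ∃ j, n = 2 * j := ⟨n / 2, by omega⟩
  rw [thueMorse_two_mul, thueMorse_two_mul_add_one]
  simp

/-- An even period is halved by `thueMorse_two_mul`. For an odd one above 1, a shift takes an even
`i`, where the terms at `i` and `i + 1` differ, to `4 * j + 1`, where two successive terms agree. -/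
theorem thueMorse_no_fifth_power (p : ℕ) (hp : 0 < p) :
    ∀ s, ∃ i, s ≤ i ∧ i < s + 4 * p ∧ thueMorse i ≠ thueMorse (i + p) := by
  induction p using Nat.strong_induction_on with
  | _ p ih =>
    intro s
    by_contra hcon
    push Not at hcon
    rcases Nat.even_or_odd' p with ⟨r, rfl | rfl⟩
    · obtain ⟨i, h1, h2, h3⟩ := ih r (by omega) (by omega) ((s + 1) / 2)
      have := hcon (2 * i) (by omega) (by omega)
      rw [← mul_add, thueMorse_two_mul, thueMorse_two_mul] at this
      exact h3 this
    · rcases Nat.eq_zero_or_pos r with rfl | hr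
      · exact thueMorse_ne_succ (n := 2 * ((s + 1) / 2)) (by omega)
          (hcon (2 * ((s + 1) / 2)) (by omega) (by omega))
      · obtain ⟨j, hj⟩ : ∃ j, j = (s + (2 * r + 1) + 2) / 4 := ⟨_, rfl⟩
        obtain ⟨i, hi⟩ : ∃ i, i + (2 * r + 1) = 4 * j + 1 := ⟨4 * j + 1 - (2 * r + 1), by omega⟩
        have e1 := hcon i (by omega) (by omega)
        have e2 := hcon (i + 1) (by omega) (by omega)
        have e3 : thueMorse i ≠ thueMorse (i + 1) := thueMorse_ne_succ (by omega)
        rw [hi] at e1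
        rw [show i + 1 + (2 * r + 1) = 2 * (2 * j + 1) by omega, thueMorse_two_mul,
          thueMorse_two_mul_add_one] at e2
        rw [show 4 * j + 1 = 2 * (2 * j) + 1 by ring, thueMorse_two_mul_add_one,
          thueMorse_two_mul] at e1
        exact e3 (e1.trans e2.symm)

theorem exists_thueMorse_eq (n : ℕ) (b : Bool) :
    b = thueMorse n ∨ b = thueMorse (n + 1) ∨ b = thueMorse (n + 2) := by
  by_contra hcon
  push Not at hcon
  obtain ⟨h1, h2, h3⟩ := hcon
  have e1 : thueMorse n = thueMorse (n + 1) := by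
    revert h1 h2; cases b <;> cases thueMorse n <;> cases thueMorse (n + 1) <;> simp
  have e2 : thueMorse (n + 1) = thueMorse (n + 2) := by
    revert h2 h3; cases b <;> cases thueMorse (n + 1) <;> cases thueMorse (n + 2) <;> simp
  rcases Nat.mod_two_eq_zero_or_one n with h | h
  · exact thueMorse_ne_succ h e1
  · exact thueMorse_ne_succ (n := n + 1) (by omega) e2

/-! ### Attaching binary tails to a block. -/

section Tails

variable {A : Type*}

/-- The Thue–Morse word over the letters `y`, `z` that starts with `y`. -/
def tmWord (y z : A) (n : ℕ) : A := if thueMorse n then z else y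

theorem tmWord_zero (y z : A) : tmWord y z 0 = y := by simp [tmWord, thueMorse]

theorem tmWord_mem [DecidableEq A] (y z : A) (n : ℕ) : tmWord y z n ∈ ({y, z} : Finset A) := by
  unfold tmWord; split <;> simp

theorem tmWord_inj {y z : A} (h : y ≠ z) {i j : ℕ} (hij : tmWord y z i = tmWord y z j) :
    thueMorse i = thueMorse j := by
  unfold tmWord at hij
  cases h1 : thueMorse i <;> cases h2 : thueMorse j <;> simp_all

theorem exists_tmWord_eq [DecidableEq A] {y z c : A} (n : ℕ) (hc : c ∈ ({y, z} : Finset A)) :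
    c = tmWord y z n ∨ c = tmWord y z (n + 1) ∨ c = tmWord y z (n + 2) := by
  have key : ∃ b : Bool, c = if b then z else y := by
    simp only [Finset.mem_insert, Finset.mem_singleton] at hc
    rcases hc with rfl | rfl
    · exact ⟨false, by simp⟩
    · exact ⟨true, by simp⟩
  obtain ⟨b, rfl⟩ := key
  rcases exists_thueMorse_eq n b with h | h | h <;> simp [tmWord, h]

/-- A word in which all powers have exponent less than `α`. -/
def PF (α : ℚ) (v : ℤ → A) : Prop :=
  ∀ s e p, 0 < p → Per v s e p → ((e - s : ℤ) : ℚ) < α * p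

/-- The letters from position `E` on are in `P`, and all letters of `P` occur in each block of
three of them. -/
def RightTail (v : ℤ → A) (P : Finset A) (E : ℤ) : Prop :=
  ∀ i, E ≤ i → v i ∈ P ∧ ∀ c ∈ P, c = v i ∨ c = v (i + 1) ∨ c = v (i + 2)

/-- The letters before position `E` are in `P`, and all letters of `P` occur in each block of
three of them. -/
def LeftTail (v : ℤ → A) (P : Finset A) (E : ℤ) : Prop :=
  ∀ i, i < E → v i ∈ P ∧ ∀ c ∈ P, c = v i ∨ c = v (i - 1) ∨ c = v (i - 2)

theorem exists_ne_ne [Fintype A] [DecidableEq A] (hA : 3 ≤ Fintype.card A) (x w : A) :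
    ∃ y, y ≠ x ∧ y ≠ w := by
  obtain ⟨y, -, hy⟩ := Finset.exists_mem_notMem_of_card_lt_card
    (s := {x, w}) (t := (Finset.univ : Finset A))
    (lt_of_le_of_lt Finset.card_le_two (by rw [Finset.card_univ]; omega))
  exact ⟨y, by simpa using hy⟩

/-- A block without fourth powers at its ends is the core of a power-free word with binary tails. -/
theorem exists_tails [Fintype A] [DecidableEq A] (hA : 3 ≤ Fintype.card A) {α : ℚ} (hα : 5 ≤ α)
    {v : ℤ → A} {m e : ℤ} (hme : m < e)
    (hcore : ∀ s f p, m ≤ s → f ≤ e → 0 < p → Per v s f p → ((f - s : ℤ) : ℚ) < α * p)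
    (hpre : ∀ p, FourthPrefix v m p → e < m + 4 * p)
    (hsuf : ∀ p, FourthSuffix v e p → e - 4 * p < m) :
    ∃ (Z : ℤ → A) (P P' : Finset A), PF α Z ∧ (∀ i, m ≤ i → i < e → Z i = v i) ∧
      P.card = 2 ∧ P'.card = 2 ∧ v m ∉ P ∧ v (e - 1) ∉ P' ∧ LeftTail Z P m ∧ RightTail Z P' e := by
  -- A fifth power reaching into both tails has `3 * p + 2 ≤ e - m`, by `hleft` and `hright`, and
  -- forces `v (e - p)` at position `e`. All such periods force the same letter `w`, so a right tail
  -- starting with `y ≠ w` excludes them at once.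
  obtain ⟨w, hw⟩ : ∃ w, ∀ p, 0 < p → Per v m e p → 3 * p + 2 ≤ e - m → v (e - p) = w := by
    by_cases h : ∃ p, 0 < p ∧ Per v m e p ∧ 3 * p + 2 ≤ e - m
    · obtain ⟨q, hq, hq1, hq2⟩ := h
      refine ⟨v (e - q), fun p hp hp1 hp2 => ?_⟩
      have e1 := hq1 (e - p - q) (by omega) (by omega)
      have e2 := hp1 (e - p - q) (by omega) (by omega)
      rw [show e - p - q + q = e - p by ring] at e1
      rw [show e - p - q + p = e - q by ring] at e2
      rw [← e1, e2]
    · exact ⟨v 0, fun p h1 h2 h3 => absurd ⟨p, h1, h2, h3⟩ h⟩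
  obtain ⟨y, hyx, hyw⟩ := exists_ne_ne hA (v (e - 1)) w
  obtain ⟨z, hzx, hzy⟩ := exists_ne_ne hA (v (e - 1)) y
  obtain ⟨y', hyx', -⟩ := exists_ne_ne hA (v m) w
  obtain ⟨z', hzx', hzy'⟩ := exists_ne_ne hA (v m) y'
  have hP : v m ∉ ({y', z'} : Finset A) := by simp [hyx'.symm, hzx'.symm]
  have hP' : v (e - 1) ∉ ({y, z} : Finset A) := by simp [hyx.symm, hzx.symm]
  obtain ⟨Z, hZ⟩ : ∃ Z : ℤ → A, Z = fun i => if i < m then tmWord y' z' (m - 1 - i).toNat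
    else if i < e then v i else tmWord y z (i - e).toNat := ⟨_, rfl⟩
  have hZv : ∀ i, m ≤ i → i < e → Z i = v i := fun i h1 h2 => by
    simp only [hZ, if_neg (not_lt.mpr h1), if_pos h2]
  have hZl : ∀ i : ℤ, ∀ n : ℕ, i = m - 1 - n → Z i = tmWord y' z' n := fun i n h => by
    simp only [hZ, if_pos (show i < m by omega), show (m - 1 - i).toNat = n by omega]
  have hZr : ∀ i : ℤ, ∀ n : ℕ, i = e + n → Z i = tmWord y z n := fun i n h => by
    simp only [hZ, if_neg (show ¬ i < m by omega), if_neg (show ¬ i < e by omega),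
      show (i - e).toNat = n by omega]
  have hL : LeftTail Z {y', z'} m := by
    intro i hi
    obtain ⟨n, hn⟩ : ∃ n : ℕ, i = m - 1 - n := ⟨(m - 1 - i).toNat, by omega⟩
    rw [hZl i n hn, hZl (i - 1) (n + 1) (by omega), hZl (i - 2) (n + 2) (by omega)]
    exact ⟨tmWord_mem .., fun c hc => exists_tmWord_eq n hc⟩
  have hR : RightTail Z {y, z} e := by
    intro i hi
    obtain ⟨n, hn⟩ : ∃ n : ℕ, i = e + n := ⟨(i - e).toNat, by omega⟩
    rw [hZr i n hn, hZr (i + 1) (n + 1) (by omega), hZr (i + 2) (n + 2) (by omega)]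
    exact ⟨tmWord_mem .., fun c hc => exists_tmWord_eq n hc⟩
  refine ⟨Z, {y', z'}, {y, z}, ?_, hZv, Finset.card_pair hzy'.symm, Finset.card_pair hzy.symm,
    hP, hP', hL, hR⟩
  intro s f p hp hper
  by_contra hge
  have h5 : 5 * p ≤ f - s := by
    have hp' : (0 : ℚ) < p := by exact_mod_cast hp
    have : (5 : ℚ) * p ≤ ((f - s : ℤ) : ℚ) := by nlinarith
    exact_mod_cast this
  have hright : s < e → e < f → f ≤ e - 1 + p := fun h1 h2 => by
    by_contra hlt
    have := hper (e - 1) (by omega) (by omega)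
    rw [hZv (e - 1) (by omega) (by omega)] at this
    exact hP' (this ▸ (hR _ (by omega)).1)
  have hleft : s < m → m < f → m - p < s := fun h1 h2 => by
    by_contra hlt
    have := hper (m - p) (by omega) (by omega)
    rw [sub_add_cancel, hZv m le_rfl hme] at this
    exact hP (this ▸ (hL _ (by omega)).1)
  have hZper : ∀ a b, Per Z a b p → m ≤ a → b ≤ e → Per v a b p := fun a b h h1 h2 i hi hi' => by
    rw [← hZv i (by omega) (by omega), ← hZv (i + p) (by omega) (by omega)]
    exact h i hi hi'
  by_cases h1 : e ≤ s
  · obtain ⟨i, hi1, hi2, hi3⟩ := thueMorse_no_fifth_power p.toNat (by omega) (s - e).toNat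
    have := hper (e + i) (by omega) (by omega)
    rw [hZr (e + i) i rfl, hZr (e + i + p) (i + p.toNat) (by push_cast; omega)] at this
    exact hi3 (tmWord_inj hzy.symm this)
  by_cases h2 : f ≤ m
  · obtain ⟨i, hi1, hi2, hi3⟩ := thueMorse_no_fifth_power p.toNat (by omega) (m - f).toNat
    have := hper (m - 1 - i - p) (by omega) (by omega)
    rw [hZl (m - 1 - i - p) (i + p.toNat) (by push_cast; omega),
      hZl (m - 1 - i - p + p) i (by omega)] at this
    exact hi3 (tmWord_inj hzy'.symm this).symm
  by_cases h3 : m ≤ s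
  · by_cases h4 : f ≤ e
    · exact hge (hcore s f p h3 h4 hp (hZper _ _ hper h3 h4))
    · have := hright (by omega) (by omega)
      have := hsuf p ⟨hp, hZper _ _ (hper.mono (by omega) (by omega)) (by omega) le_rfl⟩
      omega
  · have hl := hleft (by omega) (by omega)
    by_cases h4 : f ≤ e
    · have := hpre p ⟨hp, hZper _ _ (hper.mono (by omega) (by omega)) le_rfl (by omega)⟩
      omega
    · have hr := hright (by omega) (by omega)
      have h6 := hw p hp (hZper _ _ (hper.mono (by omega) (by omega)) le_rfl le_rfl) (by omega)
      have h7 := hper (e - p) (by omega) (by omega)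
      rw [hZv (e - p) (by omega) (by omega), h6, sub_add_cancel,
        hZr e 0 (by simp), tmWord_zero] at h7
      exact hyw h7.symm

end Tails

/-! ### Joining two words along their tails. -/

section Glue

variable {A : Type*}

theorem exists_mem_notMem_of_card_eq {P Q : Finset A} (h : P.card = Q.card) (hne : P ≠ Q) :
    ∃ a ∈ P, a ∉ Q := by
  by_contra hcon
  push Not at hcon
  exact hne (Finset.eq_of_subset_of_card_le hcon h.ge)

/-- Power-free words with binary tails over different pairs of letters can be joined. -/
theorem PF.glue {α : ℚ} (hα : 5 ≤ α) {Z₁ Z₂ : ℤ → A} (h₁ : PF α Z₁) (h₂ : PF α Z₂)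
    {P₀ P₁ P₂ P₃ : Finset A} {S₁ E₁ S₂ E₂ : ℤ}
    (hL₁ : LeftTail Z₁ P₀ S₁) (hR₁ : RightTail Z₁ P₁ E₁)
    (hL₂ : LeftTail Z₂ P₂ S₂) (hR₂ : RightTail Z₂ P₃ E₂)
    (hc₀ : P₀.card = 2) (hc₁ : P₁.card = 2) (hc₂ : P₂.card = 2) (hc₃ : P₃.card = 2)
    (hne : P₁ ≠ P₂) (B₁ B₂ : ℤ) :
    ∃ (G : ℤ → A) (t S E : ℤ), PF α G ∧ (∀ i, i ≤ B₁ → G i = Z₁ i) ∧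
      (∀ i, B₂ ≤ i → G (i + t) = Z₂ i) ∧ B₁ < B₂ + t ∧ LeftTail G P₀ S ∧ RightTail G P₃ E := by
  obtain ⟨a, ha₁, ha₂⟩ := exists_mem_notMem_of_card_eq (hc₁.trans hc₂.symm) hne
  obtain ⟨c, hc, hc'⟩ := exists_mem_notMem_of_card_eq (hc₂.trans hc₁.symm) hne.symm
  -- The part of the tail that is kept has length at least 5, which later excludes `p ≤ 4`, and at
  -- least `E₁ - S₁`, so that two periods step over both tail and core.
  obtain ⟨K₁, hK₁, hK₁E, hK₁B, ha⟩ : ∃ K, E₁ + 5 ≤ K ∧ 2 * E₁ - S₁ ≤ K ∧ B₁ < K ∧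
      Z₁ (K - 1) = a := by
    obtain ⟨M, hM⟩ : ∃ M, M = |E₁| + |2 * E₁ - S₁| + |B₁| + 5 := ⟨_, rfl⟩
    have i1 := le_abs_self E₁
    have i2 := le_abs_self (2 * E₁ - S₁)
    have i3 := le_abs_self B₁
    have j1 := abs_nonneg E₁
    have j2 := abs_nonneg (2 * E₁ - S₁)
    have j3 := abs_nonneg B₁
    rcases (hR₁ M (by omega)).2 a ha₁ with h | h | h
    · exact ⟨M + 1, by omega, by omega, by omega, by rw [h]; congr 1; ring⟩
    · exact ⟨M + 2, by omega, by omega, by omega, by rw [h]; congr 1; ring⟩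
    · exact ⟨M + 3, by omega, by omega, by omega, by rw [h]; congr 1; ring⟩
  obtain ⟨K₂, hK₂, hK₂E, hK₂B, hcK⟩ : ∃ K, K + 5 ≤ S₂ ∧ K ≤ 2 * S₂ - E₂ ∧ K ≤ B₂ ∧
      Z₂ K = c := by
    obtain ⟨M, hM⟩ : ∃ M, M = -(|S₂| + |2 * S₂ - E₂| + |B₂| + 5) := ⟨_, rfl⟩
    have i1 := neg_abs_le S₂
    have i2 := neg_abs_le (2 * S₂ - E₂)
    have i3 := neg_abs_le B₂
    have j1 := abs_nonneg S₂
    have j2 := abs_nonneg (2 * S₂ - E₂)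
    have j3 := abs_nonneg B₂
    rcases (hL₂ M (by omega)).2 c hc with h | h | h
    · exact ⟨M, by omega, by omega, by omega, h.symm⟩
    · exact ⟨M - 1, by omega, by omega, by omega, h.symm⟩
    · exact ⟨M - 2, by omega, by omega, by omega, h.symm⟩
  obtain ⟨G, hG⟩ : ∃ G : ℤ → A, G = fun i => if i < K₁ then Z₁ i else Z₂ (i - K₁ + K₂) := ⟨_, rfl⟩
  have hGl : ∀ i, i < K₁ → G i = Z₁ i := fun i h => by simp only [hG, if_pos h]
  have hGr : ∀ i j, K₂ ≤ j → i = j + (K₁ - K₂) → G i = Z₂ j := fun i j h hij => by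
    simp only [hG, if_neg (show ¬ i < K₁ by omega)]; congr 1; omega
  refine ⟨G, K₁ - K₂, min S₁ K₁, max (E₂ + (K₁ - K₂)) K₁, ?_, fun i hi => hGl i (by omega),
    fun i hi => hGr _ i (by omega) rfl, by omega, fun i hi => ?_, fun i hi => ?_⟩
  · intro s e p hp hper
    by_contra hge
    have h5 : 5 * p ≤ e - s := by
      have hp' : (0 : ℚ) < p := by exact_mod_cast hp
      have : (5 : ℚ) * p ≤ ((e - s : ℤ) : ℚ) := by nlinarith
      exact_mod_cast this
    by_cases hcl : e ≤ K₁
    · exact hge (h₁ s e p hp fun i hi hi' => by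
        rw [← hGl i (by omega), ← hGl (i + p) (by omega)]; exact hper i hi hi')
    by_cases hcr : K₁ ≤ s
    · refine hge ?_
      have := h₂ (s - (K₁ - K₂)) (e - (K₁ - K₂)) p hp fun i hi hi' => by
        rw [← hGr (i + (K₁ - K₂)) i (by omega) rfl,
          ← hGr (i + (K₁ - K₂) + p) (i + p) (by omega) (by ring)]
        exact hper _ (by omega) (by omega)
      rwa [sub_sub_sub_cancel_right] at this
    have hGa : G (K₁ - 1) = a := by rw [hGl _ (by omega), ha]
    have hGc : G K₁ = c := by rw [hGr K₁ K₂ le_rfl (by ring), hcK]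
    -- The letter `a` is not in `P₂`, so its repetition one period later falls beyond the left tail
    -- of `Z₂`.
    have hright : K₁ + p < e → S₂ - K₂ < p := fun h => by
      by_contra hlt
      have h6 := hper (K₁ - 1) (by omega) (by omega)
      rw [hGa, hGr (K₁ - 1 + p) (K₂ - 1 + p) (by omega) (by ring)] at h6
      exact ha₂ (h6 ▸ (hL₂ _ (by omega)).1)
    have hleft : s ≤ K₁ - p → K₁ - E₁ < p := fun h => by
      by_contra hlt
      have h6 := hper (K₁ - p) (by omega) (by omega)
      rw [sub_add_cancel, hGc, hGl (K₁ - p) (by omega)] at h6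
      exact hc' (h6 ▸ (hR₁ _ (by omega)).1)
    have htwo : ∀ i, s ≤ i → i + p * 2 < e → G i = G (i + p * 2) := fun i hi hi' => by
      simpa using hper.eq_add_mul hp 2 i hi (by simpa using hi')
    -- Two periods to the right of the cut the letters are in `P₃`. The three letters after the cut
    -- exhaust `P₂`, so `P₂ = P₃`; but `a`, just before the cut, is then in `P₂` too.
    by_cases hr : K₁ + (2 * p + 3) ≤ e
    · have hp2 := hright (by omega)
      have hmem : ∀ j, -1 ≤ j → j ≤ 2 → G (K₁ + j) ∈ P₃ := fun j hj hj' => by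
        rw [htwo _ (by omega) (by omega),
          hGr _ (K₂ + j + p * 2) (by omega) (by ring)]
        exact (hR₂ _ (by omega)).1
      have hsub : P₂ ⊆ P₃ := fun d hd => by
        rcases (hL₂ (K₂ + 2) (by omega)).2 d hd with h | h | h
        · rw [h, ← hGr (K₁ + 2) (K₂ + 2) (by omega) (by ring)]
          exact hmem 2 (by omega) (by omega)
        · rw [h, ← hGr (K₁ + 1) (K₂ + 2 - 1) (by omega) (by ring)]
          exact hmem 1 (by omega) (by omega)
        · rw [h, ← hGr (K₁ + 0) (K₂ + 2 - 2) (by omega) (by ring)]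
          exact hmem 0 (by omega) (by omega)
      rw [Finset.eq_of_subset_of_card_le hsub (by omega)] at ha₂
      exact ha₂ (hGa ▸ hmem (-1) (by omega) (by omega))
    by_cases hl : s ≤ K₁ - (2 * p + 3)
    · have hp2 := hleft (by omega)
      have hmem : ∀ j, -3 ≤ j → j ≤ 0 → G (K₁ + j) ∈ P₀ := fun j hj hj' => by
        have := htwo (K₁ + j - p * 2) (by omega) (by omega)
        rw [sub_add_cancel] at this
        rw [← this, hGl _ (by omega)]
        exact (hL₁ _ (by omega)).1
      have hsub : P₁ ⊆ P₀ := fun d hd => by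
        rcases (hR₁ (K₁ + -3) (by omega)).2 d hd with h | h | h
        · rw [h, ← hGl _ (by omega)]
          exact hmem (-3) (by omega) (by omega)
        · rw [h, ← hGl _ (by omega), add_assoc]
          exact hmem (-3 + 1) (by omega) (by omega)
        · rw [h, ← hGl _ (by omega), add_assoc]
          exact hmem (-3 + 2) (by omega) (by omega)
      rw [Finset.eq_of_subset_of_card_le hsub (by omega)] at hc'
      have h0 := hmem 0 (by omega) le_rfl
      rw [add_zero, hGc] at h0
      exact hc' h0
    -- Now `e - s ≤ 4 * p + 4`, hence `p ≤ 4`, whereas `hright` or `hleft` gives `p > 5`.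
    by_cases hr' : K₁ + p < e
    · have := hright hr'
      omega
    · have := hleft (by omega)
      omega
  · rw [hGl i (by omega), hGl (i - 1) (by omega), hGl (i - 2) (by omega)]
    exact hL₁ i (by omega)
  · rw [hGr i (i - (K₁ - K₂)) (by omega) (by ring),
      hGr (i + 1) (i - (K₁ - K₂) + 1) (by omega) (by ring),
      hGr (i + 2) (i - (K₁ - K₂) + 2) (by omega) (by ring)]
    exact hR₂ _ (by omega)

end Glue

/-! ### Translation between powers as lists and periods of blocks. -/

section Lists

variable {A : Type*}

theorem getElem?_flatten_replicate_append {r t : List A} (hr : r ≠ []) (ht : t <+: r) (n : ℕ) :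
    ∀ i, i < ((List.replicate n r).flatten ++ t).length →
      ((List.replicate n r).flatten ++ t)[i]? = r[i % r.length]? := by
  have hpos : 0 < r.length := List.length_pos_iff.2 hr
  induction n with
  | zero =>
    intro i hi
    simp only [List.replicate_zero, List.flatten_nil, List.nil_append] at hi ⊢
    have := ht.length_le
    obtain ⟨x, rfl⟩ := ht
    rw [Nat.mod_eq_of_lt (by omega), List.getElem?_append_left hi]
  | succ n ih =>
    intro i hi
    rw [List.replicate_succ, List.flatten_cons, List.append_assoc] at hi ⊢
    by_cases h : i < r.length
    · rw [List.getElem?_append_left h, Nat.mod_eq_of_lt h]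
    · rw [List.getElem?_append_right (by omega), ih _ (by rw [List.length_append] at hi; omega),
        ← Nat.mod_eq_sub_mod (by omega)]

/-- The block of length `n` of `v` that starts at `i`. -/
def block (v : ℤ → A) (i : ℤ) (n : ℕ) : List A := (List.range n).map fun j : ℕ => v (i + (j : ℤ))

theorem length_block (v : ℤ → A) (i : ℤ) (n : ℕ) : (block v i n).length = n := by simp [block]

theorem getElem?_block (v : ℤ → A) (i : ℤ) {n j : ℕ} (h : j < n) :
    (block v i n)[j]? = some (v (i + j)) := by simp [block, h]

theorem block_add (v : ℤ → A) (i : ℤ) (m n : ℕ) :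
    block v i (m + n) = block v i m ++ block v (i + m) n := by
  simp [block, List.range_add, add_assoc]

theorem block_congr {v w : ℤ → A} {i j : ℤ} {n : ℕ}
    (h : ∀ k : ℕ, k < n → v (i + k) = w (j + k)) : block v i n = block w j n := by
  simp only [block]
  exact List.map_congr_left fun k hk => h k (List.mem_range.1 hk)

theorem exists_block_of_infix {v : ℤ → A} {i : ℤ} {n : ℕ} {u : List A} (h : u <:+: block v i n) :
    ∃ j, u = block v j u.length := by
  obtain ⟨x, y, hxy⟩ := h
  have hn : n = x.length + u.length + y.length := by
    have := congrArg List.length hxy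
    simp only [List.length_append, length_block] at this
    omega
  rw [hn, block_add, block_add] at hxy
  obtain ⟨h1, -⟩ := List.append_inj hxy (by simp [length_block])
  exact ⟨_, (List.append_inj h1 (by simp [length_block])).2⟩

theorem biPowerFree_of_PF {α : ℚ} {v : ℤ → A} (h : PF α v) : BiPowerFree α v := by
  rintro w ⟨i, n, rfl⟩ r β u hu ⟨hr, -, ⟨N, t, ht, hut⟩, rfl⟩ hle
  obtain ⟨j, hj⟩ := exists_block_of_infix (v := v) hu
  have hpos : 0 < r.length := List.length_pos_iff.2 hr
  have hq : (0 : ℚ) < r.length := by exact_mod_cast hpos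
  have key : ∀ k, k < u.length → u[k]? = r[k % r.length]? := by
    rw [hut]; exact getElem?_flatten_replicate_append hr ht N
  have hv : ∀ k : ℕ, k < u.length → some (v (j + k)) = r[k % r.length]? := fun k hk => by
    rw [← key k hk, ← getElem?_block v j hk, ← hj]
  have := h j (j + u.length) r.length (by exact_mod_cast hpos) (by
    intro x h1 h2
    obtain ⟨k, rfl⟩ : ∃ k : ℕ, x = j + k := ⟨(x - j).toNat, by omega⟩
    have e1 := hv k (by omega)
    have e2 := hv (k + r.length) (by omega)
    rw [Nat.add_mod_right, ← e1] at e2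
    push_cast at e2
    rw [← add_assoc] at e2
    exact (Option.some.inj e2).symm)
  rw [le_div_iff₀ hq] at hle
  push_cast at this
  linarith

theorem PF_of_biPowerFree {α : ℚ} (hα : 0 < α) {v : ℤ → A} (h : BiPowerFree α v) : PF α v := by
  intro s e p hp hper
  by_contra hge
  rw [not_lt] at hge
  have hp' : (0 : ℚ) < p := by exact_mod_cast hp
  have hes : s < e := by
    have : (0 : ℚ) < ((e - s : ℤ) : ℚ) := lt_of_lt_of_le (by positivity) hge
    have : 0 < e - s := by exact_mod_cast this
    omega
  lift p to ℕ using hp.le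
  obtain ⟨n, hn⟩ : ∃ n : ℕ, e = s + n := ⟨(e - s).toNat, by omega⟩
  subst hn
  have hp0 : 0 < p := by exact_mod_cast hp
  have hlen : (block v s p).length = p := length_block ..
  have hr : block v s p ≠ [] := List.length_pos_iff.1 (by omega)
  have hpre : (block v s p).take (n % p) <+: block v s p := List.take_prefix _ _
  have hul : ((List.replicate (n / p) (block v s p)).flatten ++
      (block v s p).take (n % p)).length = n := by
    have := Nat.mod_lt n hp0
    simp only [List.length_append, List.length_flatten, List.map_replicate, List.sum_replicate,
      smul_eq_mul, hlen, List.length_take]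
    rw [min_eq_left this.le, mul_comm]
    exact Nat.div_add_mod n p
  -- The first `n / p` is the rational exponent; the second is the integer number of complete
  -- copies.
  refine h _ ⟨s, n, rfl⟩ (block v s p) (n / p) (block v s n) List.infix_rfl
    ⟨hr, ?_, ⟨n / p, _, hpre, ?_⟩, by rw [length_block, length_block]⟩ ?_
  · have : (0 : ℚ) < n := by exact_mod_cast (by omega : 0 < n)
    have : (0 : ℚ) < p := by exact_mod_cast hp
    positivity
  · refine List.ext_getElem? fun k => ?_
    by_cases hk : k < n
    · rw [getElem?_flatten_replicate_append hr hpre _ k (by omega), getElem?_block v s hk, hlen,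
        getElem?_block v s (Nat.mod_lt k hp0)]
      have := Nat.mod_le k p
      rw [hper.eq_of_dvd hp (i := s + (k % p : ℕ)) (j := s + k) (by omega) (by omega) (by omega)
        (by omega) ⟨(k / p : ℕ), by
          have := Nat.mod_add_div k p
          have h2 : ((k % p + p * (k / p) : ℕ) : ℤ) = k := by rw [this]
          push_cast at h2 ⊢
          linarith⟩]
    · rw [List.getElem?_eq_none (by rw [length_block]; omega), List.getElem?_eq_none (by omega)]
  · rw [le_div_iff₀ (by exact_mod_cast hp)]
    push_cast at hge
    linarith

end Lists

/-! ### From arbitrary power-free words to a common one. -/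

section Transition

variable {A : Type*} {α : ℚ}

theorem PF.not_per {v : ℤ → A} (h : PF α v) {Q : ℤ} (hQ : 0 < Q) :
    ∃ L : ℤ, ∀ s, ¬ Per v s (s + L) Q := by
  refine ⟨⌈α * Q⌉, fun s hs => ?_⟩
  have h1 := h _ _ _ hQ hs
  rw [add_sub_cancel_left] at h1
  exact absurd (Int.le_ceil (α * Q)) (not_le.2 h1)

variable [Fintype A] [DecidableEq A]

/-- Every block of a power-free word occurs in a power-free word with binary tails. -/
theorem PF.exists_tails (hA : 3 ≤ Fintype.card A) (hα : 5 ≤ α) {v : ℤ → A} (h : PF α v)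
    {M N : ℤ} (hMN : M < N) :
    ∃ (Z : ℤ → A) (P P' : Finset A) (S E : ℤ), PF α Z ∧ (∀ i, M ≤ i → i < N → Z i = v i) ∧
      P.card = 2 ∧ P'.card = 2 ∧ LeftTail Z P S ∧ RightTail Z P' E := by
  obtain ⟨m, e, hm, he, h1, h2⟩ := exists_block_no_fourth (v := v)
    (fun Q N hQ hcon => by
      obtain ⟨L, hL⟩ := h.not_per hQ
      exact hL N fun i hi _ => hcon i hi)
    (fun Q N hQ hcon => by
      obtain ⟨L, hL⟩ := h.not_per hQ
      refine hL (N - L) fun i _ hi => ?_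
      rw [hcon (i + Q) (by omega), add_sub_cancel_right]) M N
  obtain ⟨Z, P, P', hZ, hag, hP, hP', -, -, hL, hR⟩ := PowerFreeWords.exists_tails hA hα
    (by omega : m < e) (fun s f p _ _ hp hper => h s f p hp hper) h1 h2
  exact ⟨Z, P, P', m, e, hZ, fun i _ _ => hag i (by omega) (by omega), hP, hP', hL, hR⟩

/-- There is a power-free word whose tails avoid a given letter. -/
theorem exists_tails_avoiding (hA : 3 ≤ Fintype.card A) (hα : 5 ≤ α) (a : A) :
    ∃ (Z : ℤ → A) (P P' : Finset A) (S E : ℤ), PF α Z ∧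
      P.card = 2 ∧ P'.card = 2 ∧ a ∉ P ∧ a ∉ P' ∧ LeftTail Z P S ∧ RightTail Z P' E := by
  -- The core is the single letter `a`, which is thus the end letter that both tails avoid.
  obtain ⟨Z, P, P', hZ, -, hP, hP', ha, ha', hL, hR⟩ := exists_tails hA hα (v := fun _ => a)
    (m := 0) (e := 1) one_pos (fun s f p hs hf hp _ => by
      have h1 : ((f - s : ℤ) : ℚ) ≤ 1 := by exact_mod_cast (by omega : f - s ≤ 1)
      have h2 : (1 : ℚ) ≤ p := by exact_mod_cast hp
      nlinarith)
    (fun p hp => by have := hp.1; omega) (fun p hp => by have := hp.1; omega)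
  exact ⟨Z, P, P', 0, 1, hZ, hP, hP', ha, ha', hL, hR⟩

theorem PF.transition (hA : 3 ≤ Fintype.card A) (hα : 5 ≤ α) {v₁ v₂ : ℤ → A}
    (h₁ : PF α v₁) (h₂ : PF α v₂) {M₁ N₁ M₂ N₂ : ℤ} (hMN₁ : M₁ < N₁) (hMN₂ : M₂ < N₂) :
    ∃ (G : ℤ → A) (t : ℤ), PF α G ∧ (∀ i, M₁ ≤ i → i < N₁ → G i = v₁ i) ∧
      (∀ i, M₂ ≤ i → i < N₂ → G (i + t) = v₂ i) ∧ N₁ < M₂ + t := by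
  obtain ⟨Z₁, P₀, P₁, S₁, E₁, hZ₁, hag₁, hP₀, hP₁, hL₁, hR₁⟩ := h₁.exists_tails hA hα hMN₁
  obtain ⟨Z₂, P₂, P₃, S₂, E₂, hZ₂, hag₂, hP₂, hP₃, hL₂, hR₂⟩ := h₂.exists_tails hA hα hMN₂
  suffices h : ∃ (G : ℤ → A) (t : ℤ), PF α G ∧ (∀ i, i ≤ N₁ → G i = Z₁ i) ∧
      (∀ i, M₂ ≤ i → G (i + t) = Z₂ i) ∧ N₁ < M₂ + t by
    obtain ⟨G, t, hG, ha, hb, hlt⟩ := h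
    exact ⟨G, t, hG, fun i hi hi' => by rw [ha i hi'.le, hag₁ i hi hi'],
      fun i hi hi' => by rw [hb i hi, hag₂ i hi hi'], hlt⟩
  by_cases hne : P₁ = P₂
  · obtain ⟨a, ha⟩ : P₁.Nonempty := Finset.card_pos.1 (by omega)
    -- `Z` can follow `Z₁` and precede `Z₂`: the letter `a` of `P₁ = P₂` is in neither `P` nor `P'`.
    -- Which part of `Z` survives is irrelevant, so the bound `0` below is arbitrary.
    obtain ⟨Z, P, P', S, E, hZ, hP, hP', haP, haP', hL, hR⟩ := exists_tails_avoiding hA hα a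
    obtain ⟨G, -, S', E', hG, hag, -, -, hL', hR'⟩ := PF.glue hα hZ₁ hZ hL₁ hR₁ hL hR hP₀ hP₁ hP hP'
      (fun h => haP (h ▸ ha)) N₁ 0
    obtain ⟨H, t, -, -, hH, hagH, hagH', hlt, -, -⟩ := PF.glue hα hG hZ₂ hL' hR' hL₂ hR₂ hP₀ hP' hP₂
      hP₃ (fun h => haP' (h ▸ hne ▸ ha)) N₁ M₂
    exact ⟨H, t, hH, fun i hi => by rw [hagH i hi, hag i hi], hagH', hlt⟩
  · obtain ⟨G, t, -, -, hG, hag, hag', hlt, -, -⟩ := PF.glue hα hZ₁ hZ₂ hL₁ hR₁ hL₂ hR₂ hP₀ hP₁ hP₂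
      hP₃ hne N₁ M₂
    exact ⟨G, t, hG, hag, hag', hlt⟩

end Transition

end PowerFreeWords

theorem mainTheorem1 (k : ℕ) (hk : 3 ≤ k) (α : ℚ) (hα : 5 ≤ α)
    (v₁ v₂ : ℤ → Fin k)
    (hv₁ : PowerFreeWords.BiPowerFree α v₁) (hv₂ : PowerFreeWords.BiPowerFree α v₂)
    (w₃ w₄ : List (Fin k)) (hw₃ : w₃ ≠ []) (hw₄ : w₄ ≠ [])
    (hf₃ : PowerFreeWords.IsFactor w₃ v₁) (hf₄ : PowerFreeWords.IsFactor w₄ v₂) :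
    ∃ (w₀ : List (Fin k)) (v : ℤ → Fin k),
      PowerFreeWords.BiPowerFree α v ∧ PowerFreeWords.IsFactor (w₃ ++ w₀ ++ w₄) v := by
  obtain ⟨i₃, n₃, h₃⟩ := hf₃
  obtain ⟨i₄, n₄, h₄⟩ := hf₄
  have hn₃ : 0 < n₃ := Nat.pos_of_ne_zero fun h => hw₃ (by rw [h₃, h]; rfl)
  have hn₄ : 0 < n₄ := Nat.pos_of_ne_zero fun h => hw₄ (by rw [h₄, h]; rfl)
  have hα0 : (0 : ℚ) < α := by linarith
  obtain ⟨G, t, hG, ha, hb, hlt⟩ := PowerFreeWords.PF.transition (by simpa using hk) hα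
    (PowerFreeWords.PF_of_biPowerFree hα0 hv₁) (PowerFreeWords.PF_of_biPowerFree hα0 hv₂)
    (M₁ := i₃) (N₁ := i₃ + n₃) (M₂ := i₄) (N₂ := i₄ + n₄) (by omega) (by omega)
  obtain ⟨n₀, hn₀⟩ : ∃ n₀ : ℕ, i₄ + t = i₃ + n₃ + n₀ := ⟨(i₄ + t - (i₃ + n₃)).toNat, by omega⟩
  refine ⟨PowerFreeWords.block G (i₃ + n₃) n₀, G, PowerFreeWords.biPowerFree_of_PF hG,
    i₃, n₃ + n₀ + n₄, ?_⟩
  have e₃ : w₃ = PowerFreeWords.block G i₃ n₃ := h₃.trans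
    (PowerFreeWords.block_congr fun j hj => (ha _ (by omega) (by omega)).symm)
  have e₄ : w₄ = PowerFreeWords.block G (i₄ + t) n₄ := h₄.trans
    (PowerFreeWords.block_congr fun j hj => by
      rw [← hb _ (by omega) (by omega)]; congr 1; ring)
  rw [e₃, e₄, hn₀]
  change _ = PowerFreeWords.block G i₃ (n₃ + n₀ + n₄)
  rw [PowerFreeWords.block_add, PowerFreeWords.block_add]
  push_cast
  rw [add_assoc i₃]
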